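/- Let $X$ be a real random variable with distribution function $F(t)=\mathbb P(X\le t)$, let $\alpha\in(0,\tfrac12)$, and set \[ \mathrm{VaR}_u(F)=\inf\{t: F(t)\ge u\},\qquad \mathrm{ES}_\alpha(X)=\frac1\alpha\int_{1-\alpha}^1 \mathrm{VaR}_u(F)\,du, \] \[ \sigma^2=\sigma^2_{\mathrm{ES}_\alpha(X)}=\frac1{\alpha^2}\int_{\mathrm{VaR}_{1-\alpha}(F)}^\infty\int_{\mathrm{VaR}_{1-\alpha}(F)}^\infty \big(F(\min\{t,s\})-F(t)F(s)\big)\,dt\,ds\in[0,\infty]. \] Let $X_1,\dots,X_N$ be independent copies of $X$ and let $0.35\le\beta_1\le\beta_2\le0.65$. For a nonempty $I\subset\{1,\dots,N\}$ let $\widehat T_I=\frac1\alpha\int_{1-\alpha}^1\mathrm{VaR}_u(\widehat F_I)\,du$ with $\widehat F_I(t)=\frac1{|I|}\sum_{i\in I}\mathbf 1_{\{X_i\le t\}}$, and let $\widehat T_N=\widehat T_{\{1,\dots,N\}}$. For $\varepsilon>0$ put $m=\lceil 11/\varepsilon^2\rceil$, $n=\lfloor N/m\rfloor$, $I_j=\{(j-1)m+1,\dots,jm\}$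 for $1\le j\le n$; let $\widehat T_{(1)}\le\dots\le\widehat T_{(n)}$ be the order statistics of $(\widehat T_{I_j})_{j\le n}$, let $\widehat Q$ be the function on $[0,1]$ that takes the value $\widehat T_{(j)}$ at $\frac{j-1}{n-1}$ ($1\le j\le n$) and is linear in between, and let \[ \widehat S_N=\min\{\max\{\widehat T_N,\widehat Q(\beta_1)\},\widehat Q(\beta_2)\}. \] There are absolute constants $c_0,c_1,c_2,c_3>0$ such that the following holds for all $\alpha$, $\beta_1$, $\beta_2$, $X$ and $N$ as above. Assume that $\sigma^2<\infty$, that $u\mapsto\mathrm{VaR}_u(F)$ is $L$-Lipschitz on $[1-2\alpha,1-\frac12\alpha]$ for some $L\ge0$, that $L$ and $\sigma$ are not both zero, and that $0<\varepsilon<c_0\sqrt\alpha$ and $N\ge c_1\varepsilon^{-2}$. Then \[ \mathbb P\big(|\widehat S_N-\mathrm{ES}_\alpha(X)|\ge \varepsilon\sigma+c_2L\varepsilon^2\big)\le\exp(-c_3N\varepsilon^2), \] and if in addition $\varepsilon\le\frac{\sigma}{c_2L}$ (no condition if $L=0$), then, with the same constants, \[ \mathbb P\big(|\widehat S_N-\mathrm{ES}_\alpha(X)|\ge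 2\varepsilon\sigma\big)\le\exp(-c_3N\varepsilon^2). \] -/

import Mathlib

open MeasureTheory ProbabilityTheory
open scoped ENNReal NNReal

noncomputable section

namespace ExpShortfall

/-- The distribution function `F_X(t) = P(X ≤ t)` of a random variable. -/
def distFun {Ω : Type*} [MeasurableSpace Ω] (P : Measure Ω) (X : Ω → ℝ) (t : ℝ) : ℝ :=
  P.real {ω | X ω ≤ t}

/-- The value at risk `VaR_u(F) = inf {t : F(t) ≥ u}` of a distribution function `F`.
For `0 < u < 1` the set is nonempty and bounded below. -/
def valueAtRisk (F : ℝ → ℝ) (u : ℝ) : ℝ :=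
  sInf {t : ℝ | u ≤ F t}

/-- The expected shortfall `ES_α(F) = (1/α) ∫_{1-α}^1 VaR_u(F) du` of a distribution function. -/
def expShortfall (α : ℝ) (F : ℝ → ℝ) : ℝ :=
  (1 / α) * ∫ u in (1 - α)..1, valueAtRisk F u

/-- The variance `σ²_{ES_α}` with values in `[0, ∞]`: the double integral of
`F(min(t,s)) - F(t) F(s)` over `(VaR_{1-α}, ∞)²`, divided by `α²`.
The integrand is nonnegative for every distribution function `F`. -/
def esVariance (α : ℝ) (F : ℝ → ℝ) : ℝ≥0∞ :=
  ENNReal.ofReal (1 / α ^ 2) *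
    ∫⁻ t in Set.Ioi (valueAtRisk F (1 - α)), ∫⁻ s in Set.Ioi (valueAtRisk F (1 - α)),
      ENNReal.ofReal (F (min t s) - F t * F s)

/-- The standard deviation `σ_{ES_α}` (meaningful when `esVariance α F` is finite). -/
def esStdDev (α : ℝ) (F : ℝ → ℝ) : ℝ :=
  Real.sqrt (esVariance α F).toReal

/-- The empirical distribution function of the data `(x i)_{i ∈ I}`. -/
def empDistFun {ι : Type*} (I : Finset ι) (x : ι → ℝ) (t : ℝ) : ℝ :=
  (1 / (I.card : ℝ)) * ∑ i ∈ I, Set.indicator (Set.Iic t) (fun _ => (1 : ℝ)) (x i)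

/-- The plug-in estimator computed from the data `(x i)_{i ∈ I}`. -/
def plugIn {ι : Type*} (α : ℝ) (I : Finset ι) (x : ι → ℝ) : ℝ :=
  expShortfall α (empDistFun I x)

/-- The block size `m = ⌈11 / ε²⌉`. -/
def blockSize (ε : ℝ) : ℕ := ⌈11 / ε ^ 2⌉₊

/-- The number of blocks `n = ⌊N / m⌋` (natural-number division). -/
def numBlocks (ε : ℝ) (N : ℕ) : ℕ := N / blockSize ε

/-- The blocks of `m` consecutive indices, with data and blocks numbered from `0`:
block `j` is `{j m, …, (j + 1) m - 1}`. -/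
def block (N m j : ℕ) : Finset (Fin N) :=
  Finset.univ.filter fun i : Fin N => j * m ≤ (i : ℕ) ∧ (i : ℕ) < (j + 1) * m

/-- The order statistics of `T`, numbered from `0` (the value is `0` for `k ≥ n`). -/
def orderStat {n : ℕ} (T : Fin n → ℝ) (k : ℕ) : ℝ :=
  if h : k < n then T (Tuple.sort T ⟨k, h⟩) else 0

/-- The linearly interpolated empirical quantile function on `[0, 1]`: it takes the value
`orderStat T k` at `k / (n - 1)`, for `k = 0, …, n - 1`, and is linear between these points. -/
def interpQuantile {n : ℕ} (T : Fin n → ℝ) (β : ℝ) : ℝ :=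
  let h : ℝ := ((n : ℝ) - 1) * β
  orderStat T ⌊h⌋₊ + (h - (⌊h⌋₊ : ℝ)) * (orderStat T (⌊h⌋₊ + 1) - orderStat T ⌊h⌋₊)

/-- The plug-in estimators on the `n` blocks. -/
def blockEstimates (α ε : ℝ) {N : ℕ} (x : Fin N → ℝ) : Fin (numBlocks ε N) → ℝ :=
  fun j => plugIn α (block N (blockSize ε) (j : ℕ)) x

/-- The estimator `Ŝ_N`: the plug-in estimator on the whole sample, truncated to the interval
between the `β₁`- and the `β₂`-quantile of the block estimators. -/
def truncatedEstimator (α ε β₁ β₂ : ℝ) {N : ℕ} (x : Fin N → ℝ) : ℝ :=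
  min (max (plugIn α Finset.univ x) (interpQuantile (blockEstimates α ε x) β₁))
    (interpQuantile (blockEstimates α ε x) β₂)

end ExpShortfall

end

/-! This is a median-of-means argument. The estimator is clipped between two central quantiles of
the block estimates, so any open interval containing more than 70% of at least 100 block estimates
also contains the estimator, whatever the whole-sample plug-in value is (`interpQuantile_mem_Ioo`,
`min_max_mem_Ioo`). Hence a block only has to be good with probability 7/8: the blocks are
independent, and Hoeffding's inequality makes it exponentially unlikely that 30% of them are bad
(`measureReal_many_bad_blocks_le`).

The analysis of one block (`exists_block_bad_set`) rests on the Rockafellar–Uryasev formula: the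
expected shortfall is the minimum over `q` of the convex function `tailObjective`, attained at the
value at risk. At the true value at risk `q`, the empirical objective is `q` plus the sample mean of
`(x - q)₊ / α`. This has the right expectation, and each term has variance σ² by `variance_posPart`,
so Chebyshev gives an error of order εσ. Replacing the empirical minimiser by `q` costs at most
distance times slope (`expShortfall_mem_Icc`). With δ = 4√α ε the fluctuation scale of the tail
frequencies, the empirical quantile is within Lδ of `q` and the slope at `q` is at most δ/α in the
relevant direction, so the cost is at most 16Lε². -/

namespace ExpShortfall

open Set Filter Topology

/-! ### Quantiles and the variational formula for the expected shortfall -/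

section Quantile

variable (μ : Measure ℝ)

/-- The Galois connection between the quantile function and the distribution function. -/
theorem valueAtRisk_cdf_le_iff {u : ℝ} (hu0 : 0 < u) (hu1 : u < 1) (t : ℝ) :
    valueAtRisk (cdf μ) u ≤ t ↔ u ≤ cdf μ t := by
  have hne : {t : ℝ | u ≤ cdf μ t}.Nonempty :=
    ((tendsto_cdf_atTop μ).eventually (lt_mem_nhds hu1)).exists.imp fun _ h => h.le
  obtain ⟨b, hb⟩ := ((tendsto_cdf_atBot μ).eventually (gt_mem_nhds hu0)).exists
  have hbdd : BddBelow {t : ℝ | u ≤ cdf μ t} := by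
    refine ⟨b, fun t ht => ?_⟩
    by_contra! hlt
    exact absurd (lt_of_le_of_lt (le_trans ht (monotone_cdf μ hlt.le)) hb) (lt_irrefl _)
  refine ⟨fun h => ?_, fun h => csInf_le hbdd h⟩
  -- Right continuity of the distribution function makes the infimum attained.
  have hmem : u ≤ cdf μ (valueAtRisk (cdf μ) u) := by
    have hr := ((cdf μ).right_continuous (valueAtRisk (cdf μ) u)).tendsto.mono_left
      (nhdsWithin_mono _ Ioi_subset_Ici_self)
    refine ge_of_tendsto hr ?_
    filter_upwards [self_mem_nhdsWithin] with s hs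
    obtain ⟨r, hr, hrs⟩ := exists_lt_of_csInf_lt hne hs
    exact le_trans hr (monotone_cdf μ hrs.le)
  exact hmem.trans (monotone_cdf μ h)

theorem le_cdf_valueAtRisk {u : ℝ} (hu0 : 0 < u) (hu1 : u < 1) :
    u ≤ cdf μ (valueAtRisk (cdf μ) u) :=
  (valueAtRisk_cdf_le_iff μ hu0 hu1 _).1 le_rfl

theorem monotoneOn_valueAtRisk : MonotoneOn (valueAtRisk (cdf μ)) (Ioo 0 1) := fun _ hu _ hv huv =>
  (valueAtRisk_cdf_le_iff μ hu.1 hu.2 _).2 (huv.trans (le_cdf_valueAtRisk μ hv.1 hv.2))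

theorem aemeasurable_valueAtRisk :
    AEMeasurable (valueAtRisk (cdf μ)) (volume.restrict (Ioo 0 1)) :=
  aemeasurable_restrict_of_monotoneOn measurableSet_Ioo (monotoneOn_valueAtRisk μ)

variable [IsProbabilityMeasure μ]

/-- The quantile transform: the quantile function of a uniform variable has law `μ`. -/
theorem map_valueAtRisk : (volume.restrict (Ioo 0 1)).map (valueAtRisk (cdf μ)) = μ := by
  have : IsFiniteMeasure ((volume.restrict (Ioo (0 : ℝ) 1)).map (valueAtRisk (cdf μ))) := by
    infer_instance
  refine Measure.ext_of_Iic _ _ fun a => ?_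
  rw [Measure.map_apply_of_aemeasurable (aemeasurable_valueAtRisk μ) measurableSet_Iic]
  have h1 : (valueAtRisk (cdf μ) ⁻¹' Iic a : Set ℝ) =ᵐ[volume.restrict (Ioo 0 1)]
      (Iic (cdf μ a) : Set ℝ) := by
    filter_upwards [ae_restrict_mem measurableSet_Ioo] with u hu
    exact propext (valueAtRisk_cdf_le_iff μ hu.1 hu.2 a)
  rw [measure_congr h1, Measure.restrict_congr_set Ioo_ae_eq_Ioc, Measure.restrict_apply measurableSet_Iic,
    Iic_inter_Ioc_of_le (cdf_le_one μ a), Real.volume_Ioc, sub_zero, ofReal_cdf]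

/-- Under the quantile transform, `VaR_v < VaR_u` forces `v < u` by monotonicity, and such `v` have
Lebesgue measure `u`. -/
theorem measureReal_Iio_valueAtRisk_le {u : ℝ} (hu0 : 0 < u) (hu1 : u < 1) :
    μ.real (Iio (valueAtRisk (cdf μ) u)) ≤ u := by
  have h0 : μ.real (Iio (valueAtRisk (cdf μ) u)) =
      ((volume.restrict (Ioo 0 1)).map (valueAtRisk (cdf μ))).real
        (Iio (valueAtRisk (cdf μ) u)) := by rw [map_valueAtRisk μ]
  rw [h0, map_measureReal_apply_of_aemeasurable (aemeasurable_valueAtRisk μ) measurableSet_Iio]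
  have h1 : (volume.restrict (Ioo (0 : ℝ) 1)).real
      (valueAtRisk (cdf μ) ⁻¹' Iio (valueAtRisk (cdf μ) u)) ≤
      (volume.restrict (Ioo (0 : ℝ) 1)).real (Iio u) := by
    refine ENNReal.toReal_mono (measure_ne_top _ _) (measure_mono_ae ?_)
    filter_upwards [ae_restrict_mem measurableSet_Ioo] with v hv h
    by_contra! hle
    exact absurd h (not_lt.2 (monotoneOn_valueAtRisk μ ⟨hu0, hu1⟩ hv (not_lt.1 hle)))
  refine h1.trans ?_
  rw [measureReal_restrict_apply measurableSet_Iio, Iio_inter_Ioo, min_eq_left hu1.le,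
    Real.volume_real_Ioo_of_le hu0.le, sub_zero]

theorem measureReal_Ioi_eq (t : ℝ) : μ.real (Ioi t) = 1 - cdf μ t := by
  rw [cdf_eq_real, ← compl_Iic, probReal_compl_eq_one_sub measurableSet_Iic]

theorem measureReal_Ici_eq (t : ℝ) : μ.real (Ici t) = 1 - μ.real (Iio t) := by
  rw [← compl_Iio, probReal_compl_eq_one_sub measurableSet_Iio]

/-- The Rockafellar–Uryasev objective, whose minimum over `q` is the expected shortfall. -/
noncomputable def tailObjective (α : ℝ) (μ : Measure ℝ) (q : ℝ) : ℝ :=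
  q + (1 / α) * ∫ x, max (x - q) 0 ∂μ

/-- After the quantile transform the positive part vanishes for levels `u ≤ 1 - α` and equals `VaR_u
- q` above, so the integral is the tail integral of VaR minus `α q`. -/
theorem expShortfall_cdf_eq {α : ℝ} (hα0 : 0 < α) (hα1 : α < 1)
    (hint : Integrable (fun x => max (x - valueAtRisk (cdf μ) (1 - α)) 0) μ) :
    expShortfall α (cdf μ) = tailObjective α μ (valueAtRisk (cdf μ) (1 - α)) := by
  set q := valueAtRisk (cdf μ) (1 - α) with hq
  have hu : (1 - α) ∈ Ioo (0 : ℝ) 1 := ⟨by linarith, by linarith⟩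
  have haem := aemeasurable_valueAtRisk μ
  have hmeas : Measurable fun x : ℝ => max (x - q) 0 := by fun_prop
  have hint' : Integrable (fun u => max (valueAtRisk (cdf μ) u - q) 0)
      (volume.restrict (Ioo (0 : ℝ) 1)) := by
    rw [← map_valueAtRisk μ] at hint
    exact (integrable_map_measure hmeas.aestronglyMeasurable haem).1 hint
  have hsub : Ioo (1 - α) 1 ⊆ Ioo (0 : ℝ) 1 := Ioo_subset_Ioo_left hu.1.le
  have hon : ∀ u ∈ Ioo (1 - α) 1, max (valueAtRisk (cdf μ) u - q) 0 =
      valueAtRisk (cdf μ) u - q := fun u h =>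
    max_eq_left (sub_nonneg.2 (monotoneOn_valueAtRisk μ hu (hsub h) h.1.le))
  have hint2 : IntegrableOn (fun u => valueAtRisk (cdf μ) u - q) (Ioo (1 - α) 1) :=
    (IntegrableOn.mono_set hint' hsub).congr_fun hon measurableSet_Ioo
  have hVaR : IntegrableOn (valueAtRisk (cdf μ)) (Ioo (1 - α) 1) := by
    have := hint2.add (integrableOn_const (μ := volume) (s := Ioo (1 - α) 1) (C := q) (by simp))
    exact this.congr (Eventually.of_forall fun u => by simp)
  have h1 : ∫ x, max (x - q) 0 ∂μ = (∫ u in Ioo (1 - α) 1, valueAtRisk (cdf μ) u) - α * q := by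
    conv_lhs => rw [← map_valueAtRisk μ]
    rw [integral_map haem hmeas.aestronglyMeasurable]
    have h2 : ∫ u in Ioo (0 : ℝ) 1, max (valueAtRisk (cdf μ) u - q) 0 =
        ∫ u in Ioo (1 - α) 1, max (valueAtRisk (cdf μ) u - q) 0 := by
      refine setIntegral_eq_of_subset_of_forall_sdiff_eq_zero measurableSet_Ioo hsub fun u h => ?_
      refine max_eq_right (sub_nonpos.2 (monotoneOn_valueAtRisk μ h.1 hu ?_))
      by_contra! hlt
      exact h.2 ⟨hlt, h.1.2⟩
    rw [h2, setIntegral_congr_fun measurableSet_Ioo hon,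
      integral_sub hVaR (integrable_const _)]
    simp [hα0.le]
  rw [expShortfall, tailObjective, h1, intervalIntegral.integral_of_le (by linarith),
    integral_Ioc_eq_integral_Ioo]
  field_simp
  ring

theorem integrable_posPart_sub {q : ℝ} (h : Integrable (fun x => max (x - q) 0) μ) (r : ℝ) :
    Integrable (fun x => max (x - r) 0) μ := by
  refine (h.add (integrable_const |q - r|)).mono' (by fun_prop) (Eventually.of_forall fun x => ?_)
  rw [Real.norm_eq_abs, abs_of_nonneg (le_max_right _ _)]
  simp only [Pi.add_apply]
  refine max_le ?_ (add_nonneg (le_max_right _ _) (abs_nonneg _))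
  linarith [le_max_left (x - q) 0, le_abs_self (q - r)]

/-- Integrates the pointwise bound `(x - q)₊ + 1_S(x) (q - r) ≤ (x - r)₊`. The freedom in `S` covers
the atom at `q`: `Ioi q` gives the right derivative and `Ici q` the left one. -/
theorem tailObjective_subgradient {α : ℝ} (hα : 0 < α) {q : ℝ}
    (hint : Integrable (fun x => max (x - q) 0) μ) {S : Set ℝ} (hS : MeasurableSet S)
    (hS1 : Ioi q ⊆ S) (hS2 : S ⊆ Ici q) (r : ℝ) :
    tailObjective α μ q + (r - q) * (1 - μ.real S / α) ≤ tailObjective α μ r := by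
  have hI : Integrable (S.indicator fun _ => (q - r)) μ :=
    (integrable_const _).indicator hS
  have h : ∫ x, (max (x - q) 0 + S.indicator (fun _ => (q - r)) x) ∂μ ≤
      ∫ x, max (x - r) 0 ∂μ := by
    refine integral_mono (hint.add hI) (integrable_posPart_sub μ hint r) fun x => ?_
    by_cases hx : x ∈ S
    · have : q ≤ x := hS2 hx
      simp only [indicator_of_mem hx, max_eq_left (sub_nonneg.2 this)]
      refine le_max_of_le_left (by linarith)
    · have : x ≤ q := not_lt.1 fun hlt => hx (hS1 hlt)
      simp only [indicator_of_notMem hx, max_eq_right (sub_nonpos.2 this), add_zero]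
      exact le_max_right _ _
  rw [integral_add hint hI, integral_indicator_const _ hS, smul_eq_mul] at h
  unfold tailObjective
  have h' := mul_le_mul_of_nonneg_left h (one_div_pos.2 hα).le
  have e : (1 / α) * (μ.real S * (q - r)) = - ((r - q) * (μ.real S / α)) := by ring
  rw [mul_add, e] at h'
  linarith

theorem tailObjective_valueAtRisk_le {α : ℝ} (hα0 : 0 < α) (hα1 : α < 1)
    (hint : Integrable (fun x => max (x - valueAtRisk (cdf μ) (1 - α)) 0) μ) (r : ℝ) :
    tailObjective α μ (valueAtRisk (cdf μ) (1 - α)) ≤ tailObjective α μ r := by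
  set q := valueAtRisk (cdf μ) (1 - α) with hq
  have hu0 : 0 < 1 - α := by linarith
  have hu1 : 1 - α < 1 := by linarith
  rcases le_total q r with h | h
  · have h1 := tailObjective_subgradient μ hα0 hint measurableSet_Ioi subset_rfl Ioi_subset_Ici_self r
    have h2 : μ.real (Ioi q) / α ≤ 1 := by
      rw [div_le_one hα0, measureReal_Ioi_eq]
      linarith [le_cdf_valueAtRisk μ hu0 hu1]
    nlinarith
  · have h1 := tailObjective_subgradient μ hα0 hint measurableSet_Ici Ioi_subset_Ici_self subset_rfl r
    have h2 : 1 ≤ μ.real (Ici q) / α := by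
      rw [le_div_iff₀ hα0, measureReal_Ici_eq]
      linarith [measureReal_Iio_valueAtRisk_le μ hu0 hu1]
    nlinarith

end Quantile

/-- The plug-in functional is close to the Rockafellar–Uryasev objective at a fixed level `q`,
provided that the tail probabilities near `q` are close to `α`. -/
theorem expShortfall_mem_Icc (μ : Measure ℝ) [IsProbabilityMeasure μ] {α : ℝ} (hα0 : 0 < α)
    (hα1 : α < 1) (hint : ∀ r, Integrable (fun x => max (x - r) 0) μ)
    {q q₁ q₂ η δ : ℝ} (hδ : 0 ≤ δ) (h₁ : q - η ≤ q₁) (h₂ : q₂ ≤ q + η)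
    (hq₂ : μ.real (Ioi q₂) ≤ α) (hq₁ : α < μ.real (Ici q₁))
    (hq : α - δ < μ.real (Ici q)) (hq' : μ.real (Ioi q) < α + δ) :
    expShortfall α (cdf μ) ∈ Icc (tailObjective α μ q - η * δ / α) (tailObjective α μ q) := by
  have hu0 : 0 < 1 - α := by linarith
  have hu1 : 1 - α < 1 := by linarith
  set r := valueAtRisk (cdf μ) (1 - α) with hr
  have hES : expShortfall α (cdf μ) = tailObjective α μ r := expShortfall_cdf_eq μ hα0 hα1 (hint _)
  rw [hES]
  refine ⟨?_, tailObjective_valueAtRisk_le μ hα0 hα1 (hint _) q⟩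
  have hr2 : r ≤ q₂ := by
    rw [hr, valueAtRisk_cdf_le_iff μ hu0 hu1]
    rw [measureReal_Ioi_eq] at hq₂
    linarith
  have hr1 : q₁ ≤ r := by
    by_contra! hlt
    have hle : cdf μ r ≤ μ.real (Iio q₁) := by
      rw [cdf_eq_real]
      exact measureReal_mono fun x hx => lt_of_le_of_lt hx hlt
    rw [measureReal_Ici_eq] at hq₁
    linarith [le_cdf_valueAtRisk μ hu0 hu1]
  -- Here `a` is the distance from `q` to the minimiser and `b` the slope at `q` towards it.
  have key : ∀ a b : ℝ, 0 ≤ a → a ≤ η → -(δ / α) ≤ b → -(η * δ / α) ≤ a * b := by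
    intro a b ha haη hb
    have h1 : a * (-(δ / α)) ≤ a * b := mul_le_mul_of_nonneg_left hb ha
    have h2 : a * (δ / α) ≤ η * (δ / α) := mul_le_mul_of_nonneg_right haη (by positivity)
    rw [mul_div_assoc]
    linarith
  rcases le_total q r with h | h
  · have h3 := tailObjective_subgradient μ hα0 (hint q) measurableSet_Ioi subset_rfl
      Ioi_subset_Ici_self r
    have h4 : μ.real (Ioi q) / α ≤ 1 + δ / α := by
      rw [div_le_iff₀ hα0, add_mul, div_mul_cancel₀ _ hα0.ne']
      linarith
    have h5 := key (r - q) (1 - μ.real (Ioi q) / α) (by linarith) (by linarith) (by linarith)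
    linarith
  · have h3 := tailObjective_subgradient μ hα0 (hint q) measurableSet_Ici Ioi_subset_Ici_self
      subset_rfl r
    have h4 : 1 - δ / α ≤ μ.real (Ici q) / α := by
      rw [le_div_iff₀ hα0, sub_mul, div_mul_cancel₀ _ hα0.ne']
      linarith
    have h5 := key (q - r) (μ.real (Ici q) / α - 1) (by linarith) (by linarith) (by linarith)
    linarith

/-! ### The empirical measure -/

section Empirical

variable {m : ℕ}

/-- The mean of `f` over the data `x`. -/
noncomputable def sampleMean (f : ℝ → ℝ) (x : Fin m → ℝ) : ℝ := (1 / (m : ℝ)) * ∑ i, f (x i)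

theorem measurable_sampleMean {f : ℝ → ℝ} (hf : Measurable f) :
    Measurable (sampleMean f : (Fin m → ℝ) → ℝ) := by
  unfold sampleMean
  fun_prop

/-- The empirical measure of the data `x`. -/
noncomputable def empMeasure (x : Fin m → ℝ) : Measure ℝ :=
  (m : ℝ≥0∞)⁻¹ • ∑ i, Measure.dirac (x i)

theorem isProbabilityMeasure_empMeasure (hm : 0 < m) (x : Fin m → ℝ) :
    IsProbabilityMeasure (empMeasure x) := by
  constructor
  simp only [empMeasure, Measure.smul_apply, Measure.coe_finsetSum, Finset.sum_apply,
    measure_univ, Finset.sum_const, Finset.card_univ, Fintype.card_fin, smul_eq_mul, nsmul_eq_mul,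
    mul_one]
  exact ENNReal.inv_mul_cancel (by exact_mod_cast hm.ne') (by simp)

theorem integrable_empMeasure (hm : 0 < m) (x : Fin m → ℝ) (f : ℝ → ℝ) :
    Integrable f (empMeasure x) := by
  refine Integrable.smul_measure ?_ (by simp [hm.ne'])
  exact integrable_finsetSum_measure.2 fun i _ => integrable_dirac (by simp)

theorem integral_empMeasure (x : Fin m → ℝ) (f : ℝ → ℝ) :
    ∫ y, f y ∂(empMeasure x) = sampleMean f x := by
  rw [empMeasure, integral_smul_measure,
    integral_finsetSum_measure fun i _ => integrable_dirac (by simp)]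
  simp [sampleMean]

theorem measureReal_empMeasure (x : Fin m → ℝ) {S : Set ℝ} (hS : MeasurableSet S) :
    (empMeasure x).real S = sampleMean (S.indicator fun _ => 1) x := by
  rw [← integral_empMeasure, integral_indicator_const _ hS, smul_eq_mul, mul_one]

/-- Lets the deterministic results for probability measures apply to each realisation of the sample.
-/
theorem empDistFun_univ_eq (hm : 0 < m) (x : Fin m → ℝ) :
    empDistFun Finset.univ x = cdf (empMeasure x) := by
  have := isProbabilityMeasure_empMeasure hm x
  ext t
  rw [cdf_eq_real, measureReal_empMeasure x measurableSet_Iic]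
  simp [empDistFun, sampleMean]

theorem plugIn_image {ι : Type*} [DecidableEq ι] (α : ℝ) (e : Fin m ↪ ι) (x : ι → ℝ) :
    plugIn α (Finset.univ.map e) x = plugIn α Finset.univ fun k => x (e k) := by
  unfold plugIn
  congr 1
  ext t
  simp [empDistFun]

end Empirical

/-! ### Hoeffding's covariance formula -/

section Variance

variable (μ : Measure ℝ) [IsProbabilityMeasure μ]

theorem lintegral_indicator_Ioi (q x : ℝ) :
    ∫⁻ t in Ioi q, (Ioi t).indicator (fun _ => (1 : ℝ≥0∞)) x = ENNReal.ofReal (max (x - q) 0) := by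
  have h : ∀ t, (Ioi t).indicator (fun _ => (1 : ℝ≥0∞)) x = (Iio x).indicator 1 t := fun t => by
    by_cases h : t < x <;> simp [h, indicator]
  simp_rw [h]
  rw [lintegral_indicator_one measurableSet_Iio, Measure.restrict_apply measurableSet_Iio,
    Iio_inter_Ioi, Real.volume_Ioo]
  rcases le_total (x - q) 0 with h | h
  · rw [max_eq_right h, ENNReal.ofReal_of_nonpos h, ENNReal.ofReal_zero]
  · rw [max_eq_left h]

theorem measurable_indicator_Ioi :
    Measurable fun p : ℝ × ℝ => (Ioi p.2).indicator (fun _ => (1 : ℝ≥0∞)) p.1 := by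
  have : (fun p : ℝ × ℝ => (Ioi p.2).indicator (fun _ => (1 : ℝ≥0∞)) p.1) =
      {p : ℝ × ℝ | p.2 < p.1}.indicator fun _ => 1 := by
    ext p
    by_cases h : p.2 < p.1 <;> simp [h, indicator]
  rw [this]
  exact measurable_const.indicator (measurableSet_lt measurable_snd measurable_fst)

theorem lintegral_posPart_eq (q : ℝ) :
    ∫⁻ x, ENNReal.ofReal (max (x - q) 0) ∂μ = ∫⁻ t in Ioi q, μ (Ioi t) := by
  simp_rw [← lintegral_indicator_Ioi]
  rw [lintegral_lintegral_swap measurable_indicator_Ioi.aemeasurable]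
  simp_rw [lintegral_indicator_const measurableSet_Ioi, one_mul]

theorem lintegral_posPart_sq_eq (q : ℝ) :
    ∫⁻ x, ENNReal.ofReal (max (x - q) 0) ^ 2 ∂μ =
      ∫⁻ t in Ioi q, ∫⁻ s in Ioi q, μ (Ioi (max t s)) := by
  have h1 : ∀ x, ENNReal.ofReal (max (x - q) 0) ^ 2 =
      ∫⁻ t in Ioi q, (Ioi t).indicator (fun _ => (1 : ℝ≥0∞)) x *
        ENNReal.ofReal (max (x - q) 0) := fun x => by
    rw [lintegral_mul_const' _ _ ENNReal.ofReal_ne_top, lintegral_indicator_Ioi, sq]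
  simp_rw [h1]
  have hm : Measurable fun p : ℝ × ℝ => ENNReal.ofReal (max (p.1 - q) 0) := by fun_prop
  rw [lintegral_lintegral_swap (measurable_indicator_Ioi.mul hm).aemeasurable]
  refine lintegral_congr fun t => ?_
  have h2 : ∀ x, (Ioi t).indicator (fun _ => (1 : ℝ≥0∞)) x * ENNReal.ofReal (max (x - q) 0) =
      ∫⁻ s in Ioi q, (Ioi t).indicator (fun _ => (1 : ℝ≥0∞)) x *
        (Ioi s).indicator (fun _ => (1 : ℝ≥0∞)) x := fun x => by
    rw [lintegral_const_mul', lintegral_indicator_Ioi]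
    by_cases h : x ∈ Ioi t <;> simp [h]
  simp_rw [h2]
  have hm2 : Measurable fun p : ℝ × ℝ => (Ioi t).indicator (fun _ => (1 : ℝ≥0∞)) p.1 :=
    (measurable_const.indicator measurableSet_Ioi).comp measurable_fst
  rw [lintegral_lintegral_swap (hm2.mul measurable_indicator_Ioi).aemeasurable]
  refine lintegral_congr fun s => ?_
  have h3 : ∀ x, (Ioi t).indicator (fun _ => (1 : ℝ≥0∞)) x *
      (Ioi s).indicator (fun _ => (1 : ℝ≥0∞)) x =
      (Ioi (max t s)).indicator (fun _ => (1 : ℝ≥0∞)) x := fun x => by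
    by_cases h : t < x <;> by_cases h' : s < x <;> simp [h, h', indicator]
  simp_rw [h3, lintegral_indicator_const measurableSet_Ioi, one_mul]

theorem measure_Ioi_eq (t : ℝ) : μ (Ioi t) = ENNReal.ofReal (1 - cdf μ t) := by
  rw [← measureReal_Ioi_eq, ofReal_measureReal]

/-- The covariance kernel factors as `F(min) (1 - F(max))`. Adding the product of tails gives the
joint tail without subtraction in `ℝ≥0∞`, and `F(min) ≥ 1/2` bounds the joint tail by twice the
kernel. -/
theorem ofReal_cdf_cov_add (t s : ℝ) :
    ENNReal.ofReal (cdf μ (min t s) - cdf μ t * cdf μ s) + μ (Ioi t) * μ (Ioi s) =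
      μ (Ioi (max t s)) ∧
    (1 / 2 ≤ cdf μ (min t s) → μ (Ioi (max t s)) ≤
      2 * ENNReal.ofReal (cdf μ (min t s) - cdf μ t * cdf μ s)) := by
  have e : cdf μ (min t s) - cdf μ t * cdf μ s = cdf μ (min t s) * (1 - cdf μ (max t s)) := by
    rcases le_total t s with h | h
    · rw [min_eq_left h, max_eq_right h]; ring
    · rw [min_eq_right h, max_eq_left h]; ring
  have h0 := cdf_nonneg μ (min t s)
  have h1 := cdf_le_one μ (max t s)
  rw [measure_Ioi_eq, measure_Ioi_eq, measure_Ioi_eq]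
  constructor
  · rw [← ENNReal.ofReal_mul (by linarith [cdf_le_one μ t]), ← ENNReal.ofReal_add]
    · congr 1
      rcases le_total t s with h | h
      · rw [min_eq_left h, max_eq_right h]; ring
      · rw [min_eq_right h, max_eq_left h]; ring
    · rw [e]; exact mul_nonneg h0 (by linarith)
    · exact mul_nonneg (by linarith [cdf_le_one μ t]) (by linarith [cdf_le_one μ s])
  · intro h
    have : (2 : ℝ≥0∞) = ENNReal.ofReal 2 := by simp
    rw [this, ← ENNReal.ofReal_mul (by norm_num), e]
    refine ENNReal.ofReal_le_ofReal ?_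
    nlinarith

/-- Hoeffding's covariance formula for `(x - q)₊`, in the form used for the expected shortfall. -/
theorem variance_posPart {α : ℝ} (hα0 : 0 < α) (hα1 : α < 1 / 2)
    (hσ : esVariance α (cdf μ) ≠ ∞) :
    MemLp (fun x => max (x - valueAtRisk (cdf μ) (1 - α)) 0) 2 μ ∧
    Var[fun x => max (x - valueAtRisk (cdf μ) (1 - α)) 0; μ] =
      α ^ 2 * esStdDev α (cdf μ) ^ 2 := by
  set q := valueAtRisk (cdf μ) (1 - α) with hq
  have hFq : 1 / 2 ≤ cdf μ q := by
    linarith [le_cdf_valueAtRisk μ (u := 1 - α) (by linarith) (by linarith)]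
  set A := ∫⁻ t in Ioi q, ∫⁻ s in Ioi q,
    ENNReal.ofReal (cdf μ (min t s) - cdf μ t * cdf μ s) with hA
  have hEs : esVariance α (cdf μ) = ENNReal.ofReal (1 / α ^ 2) * A := rfl
  have hAfin : A ≠ ∞ := by
    intro h
    rw [hEs, h, ENNReal.mul_top (by simpa using hα0.ne')] at hσ
    exact hσ rfl
  set C := ∫⁻ t in Ioi q, μ (Ioi t) with hC
  set B := ∫⁻ t in Ioi q, ∫⁻ s in Ioi q, μ (Ioi (max t s)) with hB
  have hGmeas : Measurable fun t => μ (Ioi t) := by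
    simp_rw [measure_Ioi_eq]
    exact ((monotone_cdf μ).measurable.const_sub 1).ennreal_ofReal
  have hAB : A + C ^ 2 = B := by
    have h1 : C ^ 2 = ∫⁻ t in Ioi q, ∫⁻ s in Ioi q, μ (Ioi t) * μ (Ioi s) := by
      simp_rw [lintegral_const_mul _ hGmeas]
      rw [lintegral_mul_const _ hGmeas, sq]
    have h2 : ∀ t, ∫⁻ s in Ioi q, μ (Ioi (max t s)) =
        (∫⁻ s in Ioi q, ENNReal.ofReal (cdf μ (min t s) - cdf μ t * cdf μ s)) +
          ∫⁻ s in Ioi q, μ (Ioi t) * μ (Ioi s) := fun t => by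
      rw [← lintegral_add_right _ (hGmeas.const_mul _)]
      exact lintegral_congr fun s => ((ofReal_cdf_cov_add μ t s).1).symm
    rw [hB]
    simp_rw [h2]
    rw [lintegral_add_right, h1]
    simp_rw [lintegral_const_mul _ hGmeas]
    exact hGmeas.mul_const _
  -- Finite σ² gives a finite second moment: since `α < 1/2`, `F ≥ 1/2` throughout the region of
  -- integration.
  have hB2 : B ≤ 2 * A := by
    rw [hA, hB, ← lintegral_const_mul' _ _ (by simp)]
    refine setLIntegral_mono' measurableSet_Ioi fun t ht => ?_
    rw [← lintegral_const_mul' _ _ (by simp)]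
    refine setLIntegral_mono' measurableSet_Ioi fun s hs => ?_
    exact (ofReal_cdf_cov_add μ t s).2
      (hFq.trans (monotone_cdf μ (le_min (mem_Ioi.1 ht).le (mem_Ioi.1 hs).le)))
  have hBfin : B ≠ ∞ := ne_top_of_le_ne_top (ENNReal.mul_ne_top (by simp) hAfin) hB2
  have hmeas : Measurable fun x : ℝ => max (x - q) 0 := by fun_prop
  have hsq : ∀ x : ℝ, ENNReal.ofReal (max (x - q) 0 ^ 2) = ENNReal.ofReal (max (x - q) 0) ^ 2 :=
    fun x => ENNReal.ofReal_pow (le_max_right _ _) 2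
  have hBW : ∫⁻ x, ENNReal.ofReal (max (x - q) 0 ^ 2) ∂μ = B := by
    simp_rw [hsq]
    exact lintegral_posPart_sq_eq μ q
  have hL2 : MemLp (fun x => max (x - q) 0) 2 μ := by
    rw [memLp_two_iff_integrable_sq hmeas.aestronglyMeasurable]
    refine ⟨by fun_prop, ?_⟩
    rw [hasFiniteIntegral_iff_ofReal (Eventually.of_forall fun x => sq_nonneg _), hBW]
    exact hBfin.lt_top
  refine ⟨hL2, ?_⟩
  have hCfin : C ≠ ∞ := by
    intro h
    rw [h] at hAB
    exact hBfin (by rw [← hAB]; simp)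
  rw [variance_eq_sub hL2]
  have hI2 : μ[(fun x => max (x - q) 0) ^ 2] = B.toReal := by
    rw [← hBW]
    exact integral_eq_lintegral_of_nonneg_ae (Eventually.of_forall fun x => sq_nonneg _)
      (by fun_prop)
  have hI1 : μ[fun x => max (x - q) 0] = C.toReal := by
    rw [hC, ← lintegral_posPart_eq]
    exact integral_eq_lintegral_of_nonneg_ae (Eventually.of_forall fun x => le_max_right _ _)
      (by fun_prop)
  rw [hI2, hI1, ← hAB, ENNReal.toReal_add hAfin (by simp [hCfin]), ENNReal.toReal_pow,
    esStdDev, Real.sq_sqrt ENNReal.toReal_nonneg, hEs, ENNReal.toReal_mul,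
    ENNReal.toReal_ofReal (by positivity)]
  field_simp
  ring

end Variance

/-! ### One block: Chebyshev bounds and the bad event -/

section Block

variable (μ : Measure ℝ) [IsProbabilityMeasure μ] {m : ℕ}

/-- Chebyshev's inequality for the mean of `f` over an i.i.d. sample. -/
theorem chebyshev_sampleMean (hm : 0 < m) {f : ℝ → ℝ} (hf : Measurable f) (hL2 : MemLp f 2 μ)
    {c : ℝ} (hc : 0 < c) :
    (Measure.pi fun _ : Fin m => μ).real {x | c ≤ |sampleMean f x - ∫ y, f y ∂μ|} ≤
      Var[f; μ] / (m * c ^ 2) := by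
  set Q := Measure.pi fun _ : Fin m => μ with hQ
  have hm' : (0 : ℝ) < m := by exact_mod_cast hm
  have hid : ∀ i : Fin m, IdentDistrib (fun x : Fin m → ℝ => f (x i)) f Q μ := fun i =>
    ⟨(hf.comp (measurable_pi_apply i)).aemeasurable, hf.aemeasurable, by
      have h := (measurePreserving_eval (fun _ : Fin m => μ) i).map_eq
      rw [← h, Measure.map_map hf (measurable_pi_apply i)]
      rfl⟩
  have hL : ∀ i : Fin m, MemLp (fun x : Fin m → ℝ => f (x i)) 2 Q := fun i =>
    (hid i).symm.memLp_snd hL2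
  have hind : iIndepFun (fun (i : Fin m) (x : Fin m → ℝ) => f (x i)) Q :=
    iIndepFun_pi (X := fun _ => f) fun _ => hf.aemeasurable
  have hsm : (sampleMean f : (Fin m → ℝ) → ℝ) =
      fun x => (1 / (m : ℝ)) * (∑ i, fun x : Fin m → ℝ => f (x i)) x := by
    ext x
    simp [sampleMean]
  have hvar : Var[sampleMean f; Q] = Var[f; μ] / m := by
    rw [hsm, variance_const_mul, IndepFun.variance_sum (fun i _ => hL i)
      fun i _ j _ hij => hind.indepFun hij]
    simp_rw [fun i => (hid i).variance_eq]
    simp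
    field_simp
  have hmean : Q[sampleMean f] = ∫ y, f y ∂μ := by
    rw [hsm, integral_const_mul]
    simp_rw [Finset.sum_apply]
    rw [integral_finsetSum _ fun i _ => (hL i).integrable (by norm_num)]
    simp_rw [fun i => (hid i).integral_eq]
    simp
    field_simp
  have hLs : MemLp (sampleMean f) 2 Q := by
    rw [hsm]
    exact (memLp_finsetSum' _ fun i _ => hL i).const_mul _
  have h := meas_ge_le_variance_div_sq hLs hc
  rw [hmean, hvar, div_div] at h
  exact ENNReal.toReal_le_of_le_ofReal (div_nonneg (variance_nonneg _ _) (by positivity)) h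

theorem variance_indicator_le {S : Set ℝ} (hS : MeasurableSet S) :
    MemLp (S.indicator fun _ => (1 : ℝ)) 2 μ ∧
      Var[S.indicator fun _ => (1 : ℝ); μ] ≤ μ.real S := by
  have hmeas : Measurable (S.indicator fun _ => (1 : ℝ)) := measurable_const.indicator hS
  refine ⟨memLp_indicator_const 2 hS 1 (Or.inr (measure_ne_top _ _)),
    (variance_le_expectation_sq hmeas.aestronglyMeasurable).trans_eq ?_⟩
  have : (S.indicator fun _ => (1 : ℝ)) ^ 2 = S.indicator fun _ => (1 : ℝ) := by
    ext x
    by_cases h : x ∈ S <;> simp [h]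
  rw [this, integral_indicator_const _ hS, smul_eq_mul, mul_one]

omit [IsProbabilityMeasure μ] in
theorem integral_indicator_one_eq {S : Set ℝ} (hS : MeasurableSet S) :
    ∫ y, S.indicator (fun _ => (1 : ℝ)) y ∂μ = μ.real S := by
  rw [integral_indicator_const _ hS, smul_eq_mul, mul_one]

theorem frequency_upper_tail (hm : 0 < m) {S : Set ℝ} (hS : MeasurableSet S) {a δ : ℝ}
    (hδ : 0 < δ) (ha : μ.real S ≤ a) :
    (Measure.pi fun _ : Fin m => μ).real
      {x | a + δ ≤ sampleMean (S.indicator fun _ => 1) x} ≤ a / (m * δ ^ 2) := by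
  have hm' : (0 : ℝ) < m := by exact_mod_cast hm
  have h := chebyshev_sampleMean μ hm (measurable_const.indicator hS)
    (variance_indicator_le μ hS).1 hδ
  rw [integral_indicator_one_eq μ hS] at h
  refine le_trans (measureReal_mono fun x hx => ?_) (h.trans ?_)
  · rw [mem_ofPred_eq] at hx ⊢
    exact le_trans (by linarith) (le_abs_self _)
  · gcongr
    exact (variance_indicator_le μ hS).2.trans ha

/-- An atom may make `r = μ(S)` much larger than `a`, so the variance bound `r` can exceed `a`; but
the deviation grows to `r - a + δ`, and for `δ ≤ a` the Chebyshev bound is worst at `r = a`. -/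
theorem frequency_lower_tail (hm : 0 < m) {S : Set ℝ} (hS : MeasurableSet S) {a δ : ℝ}
    (hδ : 0 < δ) (hδa : δ ≤ a) (ha : a ≤ μ.real S) :
    (Measure.pi fun _ : Fin m => μ).real
      {x | sampleMean (S.indicator fun _ => 1) x ≤ a - δ} ≤ a / (m * δ ^ 2) := by
  have hm' : (0 : ℝ) < m := by exact_mod_cast hm
  set r := μ.real S with hr
  have hpos : 0 < r - a + δ := by linarith
  have h := chebyshev_sampleMean μ hm (measurable_const.indicator hS)
    (variance_indicator_le μ hS).1 hpos
  rw [integral_indicator_one_eq μ hS, ← hr] at h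
  refine le_trans (measureReal_mono fun x hx => ?_) (h.trans ?_)
  · rw [mem_ofPred_eq] at hx
    rw [mem_ofPred_eq, abs_sub_comm]
    exact le_trans (by linarith) (le_abs_self _)
  calc Var[S.indicator fun _ => (1 : ℝ); μ] / (m * (r - a + δ) ^ 2)
      ≤ r / (m * (r - a + δ) ^ 2) := by
        gcongr
        exact (variance_indicator_le μ hS).2
    _ ≤ _ := by
      rw [div_le_div_iff₀ (by positivity) (by positivity)]
      have h1 : r * δ ^ 2 ≤ a * (r - a + δ) ^ 2 := by
        obtain ⟨s, hs⟩ : ∃ s, r = a + s := ⟨r - a, by ring⟩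
        have hs0 : 0 ≤ s := by linarith
        rw [hs]
        have h2 : s * δ * δ ≤ s * δ * a := by gcongr
        have h3 : 0 ≤ a * s ^ 2 := mul_nonneg (by linarith) (sq_nonneg _)
        have h4 : 0 ≤ s * δ * a := mul_nonneg (by positivity) (by linarith)
        nlinarith
      calc r * (m * δ ^ 2) = m * (r * δ ^ 2) := by ring
        _ ≤ m * (a * (r - a + δ) ^ 2) := by gcongr
        _ = _ := by ring

/-- On a sample of size `m ≥ 11 / ε²` the plug-in estimator is within `ε σ + 32 L ε²` of the
expected shortfall, except on a measurable event of probability at most `1 / 8`. -/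
theorem exists_block_bad_set {α : ℝ} (hα0 : 0 < α) (hα1 : α < 1 / 2)
    (hσ : esVariance α (cdf μ) ≠ ∞) {L : ℝ≥0}
    (hL : LipschitzOnWith L (valueAtRisk (cdf μ)) (Icc (1 - 2 * α) (1 - α / 2)))
    (hpos : 0 < L ∨ 0 < esStdDev α (cdf μ)) {ε : ℝ} (hε : 0 < ε) (hε1 : ε < 1 / 8 * √α)
    (hm : 11 / ε ^ 2 ≤ m) :
    ∃ B : Set (Fin m → ℝ), MeasurableSet B ∧ (Measure.pi fun _ : Fin m => μ).real B ≤ 1 / 8 ∧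
      ∀ x ∉ B, |plugIn α Finset.univ x - expShortfall α (cdf μ)| <
        ε * esStdDev α (cdf μ) + 32 * L * ε ^ 2 := by
  have hm' : (0 : ℝ) < m := lt_of_lt_of_le (by positivity) hm
  have hm0 : 0 < m := by exact_mod_cast hm'
  have hm11 : 11 ≤ m * ε ^ 2 := by rwa [div_le_iff₀ (by positivity)] at hm
  have hs0 : 0 < √α := Real.sqrt_pos.2 hα0
  have hss : √α * √α = α := Real.mul_self_sqrt hα0.le
  -- Tail frequencies have standard deviation of order √(α/m), that is √α ε. The bound `ε < √α / 8`
  -- gives `δ ≤ α / 2`, keeping `1 - α ± δ` inside the Lipschitz interval.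
  set δ := 4 * √α * ε with hδ
  have hδ0 : 0 < δ := by positivity
  have hδα : δ ≤ α / 2 := by nlinarith
  have hδ2 : δ ^ 2 = 16 * α * ε ^ 2 := by
    rw [hδ, mul_pow, mul_pow, Real.sq_sqrt hα0.le]; ring
  have hmδ : 176 * α ≤ m * δ ^ 2 := by rw [hδ2]; nlinarith
  set q := valueAtRisk (cdf μ) (1 - α) with hq
  set q₁ := valueAtRisk (cdf μ) (1 - α - δ) with hq₁
  set q₂ := valueAtRisk (cdf μ) (1 - α + δ) with hq₂
  obtain ⟨hW2, hWvar⟩ := variance_posPart μ hα0 hα1 hσ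
  rw [← hq] at hW2 hWvar
  set σ := esStdDev α (cdf μ) with hσdef
  have hσ0 : 0 ≤ σ := Real.sqrt_nonneg _
  set W : ℝ → ℝ := fun x => max (x - q) 0 with hW
  have hWmeas : Measurable W := by fun_prop
  have hWint : Integrable W μ := hW2.integrable (by norm_num)
  have hES : expShortfall α (cdf μ) = q + 1 / α * ∫ y, W y ∂μ :=
    expShortfall_cdf_eq μ hα0 (by linarith) hWint
  -- Half of the `32 L ε²` goes into the Chebyshev threshold, which keeps it positive when `σ = 0`;
  -- the other half pays for the shift of the minimiser.
  set r := ε * σ + 16 * L * ε ^ 2 with hr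
  have hr0 : 0 < r := by
    rcases hpos with h | h
    · have : (0 : ℝ) < L := h
      positivity
    · positivity
  let B₀ : Set (Fin m → ℝ) := {x | α * r ≤ |sampleMean W x - ∫ y, W y ∂μ|}
  let B₁ : Set (Fin m → ℝ) := {x | (α - δ) + δ ≤ sampleMean ((Ioi q₂).indicator fun _ => 1) x}
  let B₂ : Set (Fin m → ℝ) := {x | sampleMean ((Ici q₁).indicator fun _ => 1) x ≤ (α + δ) - δ}
  let B₃ : Set (Fin m → ℝ) := {x | sampleMean ((Ici q).indicator fun _ => 1) x ≤ α - δ}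
  let B₄ : Set (Fin m → ℝ) := {x | α + δ ≤ sampleMean ((Ioi q).indicator fun _ => 1) x}
  have hind : ∀ {S : Set ℝ}, MeasurableSet S → Measurable
      (sampleMean (S.indicator fun _ => 1) : (Fin m → ℝ) → ℝ) := fun hS =>
    measurable_sampleMean (measurable_const.indicator hS)
  have hsm := measurable_sampleMean (m := m) hWmeas
  have h1ES : (1 - α - δ) ∈ Icc (1 - 2 * α) (1 - α / 2) := ⟨by linarith, by linarith⟩
  have h2ES : (1 - α + δ) ∈ Icc (1 - 2 * α) (1 - α / 2) := ⟨by linarith, by linarith⟩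
  have h3ES : (1 - α) ∈ Icc (1 - 2 * α) (1 - α / 2) := ⟨by linarith, by linarith⟩
  have hb₀ : (Measure.pi fun _ : Fin m => μ).real B₀ ≤ 1 / 11 := by
    refine (chebyshev_sampleMean μ hm0 hWmeas hW2 (by positivity)).trans ?_
    rw [hWvar, div_le_iff₀ (by positivity)]
    have h1 : (ε * σ) ^ 2 ≤ r ^ 2 := by
      have : ε * σ ≤ r := by rw [hr]; linarith [show (0 : ℝ) ≤ 16 * L * ε ^ 2 by positivity]
      gcongr
    have h2 : 11 * σ ^ 2 ≤ m * r ^ 2 := by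
      calc 11 * σ ^ 2 ≤ m * ε ^ 2 * σ ^ 2 := by gcongr
        _ = m * (ε * σ) ^ 2 := by ring
        _ ≤ _ := by gcongr
    have h3 : α ^ 2 * (11 * σ ^ 2) ≤ α ^ 2 * (m * r ^ 2) := by gcongr
    nlinarith
  have hfrac : ∀ a : ℝ, a ≤ 3 / 2 * α → a / (m * δ ^ 2) ≤ 3 / 352 := fun a ha => by
    rw [div_le_iff₀ (by positivity)]
    linarith
  have hb₁ : (Measure.pi fun _ : Fin m => μ).real B₁ ≤ 3 / 352 := by
    refine (frequency_upper_tail μ hm0 measurableSet_Ioi hδ0 ?_).trans (hfrac _ (by linarith))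
    rw [measureReal_Ioi_eq]
    linarith [le_cdf_valueAtRisk μ (u := 1 - α + δ) (by linarith) (by linarith)]
  have hb₂ : (Measure.pi fun _ : Fin m => μ).real B₂ ≤ 3 / 352 := by
    refine (frequency_lower_tail μ hm0 measurableSet_Ici hδ0 (by linarith) ?_).trans
      (hfrac _ (by linarith))
    rw [measureReal_Ici_eq]
    linarith [measureReal_Iio_valueAtRisk_le μ (u := 1 - α - δ) (by linarith) (by linarith)]
  have hb₃ : (Measure.pi fun _ : Fin m => μ).real B₃ ≤ 3 / 352 := by
    refine (frequency_lower_tail μ hm0 measurableSet_Ici hδ0 (by linarith) ?_).trans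
      (hfrac _ (by linarith))
    rw [measureReal_Ici_eq]
    linarith [measureReal_Iio_valueAtRisk_le μ (u := 1 - α) (by linarith) (by linarith)]
  have hb₄ : (Measure.pi fun _ : Fin m => μ).real B₄ ≤ 3 / 352 := by
    refine (frequency_upper_tail μ hm0 measurableSet_Ioi hδ0 ?_).trans (hfrac _ (by linarith))
    rw [measureReal_Ioi_eq]
    linarith [le_cdf_valueAtRisk μ (u := 1 - α) (by linarith) (by linarith)]
  refine ⟨B₀ ∪ (B₁ ∪ (B₂ ∪ (B₃ ∪ B₄))), ?_, ?_, ?_⟩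
  · refine .union (measurableSet_le measurable_const (hsm.sub_const _).abs) (.union
      (measurableSet_le measurable_const (hind measurableSet_Ioi)) (.union
      (measurableSet_le (hind measurableSet_Ici) measurable_const) (.union
      (measurableSet_le (hind measurableSet_Ici) measurable_const)
      (measurableSet_le measurable_const (hind measurableSet_Ioi)))))
  -- The budget is exact: 1/11 + 4 · 3/352 = 1/8.
  · have u1 := measureReal_union_le (μ := Measure.pi fun _ : Fin m => μ) B₀ (B₁ ∪ (B₂ ∪ (B₃ ∪ B₄)))
    have u2 := measureReal_union_le (μ := Measure.pi fun _ : Fin m => μ) B₁ (B₂ ∪ (B₃ ∪ B₄))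
    have u3 := measureReal_union_le (μ := Measure.pi fun _ : Fin m => μ) B₂ (B₃ ∪ B₄)
    have u4 := measureReal_union_le (μ := Measure.pi fun _ : Fin m => μ) B₃ B₄
    linarith
  · intro x hx
    simp only [mem_union, not_or, B₀, B₁, B₂, B₃, B₄, mem_ofPred_eq, not_le] at hx
    obtain ⟨h0, h1, h2, h3, h4⟩ := hx
    have := isProbabilityMeasure_empMeasure hm0 x
    have hlip : ∀ u ∈ Icc (1 - 2 * α) (1 - α / 2), |u - (1 - α)| = δ →
        |valueAtRisk (cdf μ) u - q| ≤ L * δ := fun u hu h => by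
      have := hL.dist_le_mul u hu _ h3ES
      rwa [Real.dist_eq, Real.dist_eq, h] at this
    have hl1 := abs_le.1 (hlip _ h1ES (by rw [abs_sub_comm]; ring_nf; exact abs_of_pos hδ0))
    have hl2 := abs_le.1 (hlip _ h2ES (by ring_nf; exact abs_of_pos hδ0))
    have hmain := expShortfall_mem_Icc (empMeasure x) hα0 (by linarith)
      (fun r => integrable_empMeasure hm0 x _) (q := q) (q₁ := q₁) (q₂ := q₂) (η := L * δ) (δ := δ)
      hδ0.le (by linarith) (by linarith)
      (by rw [measureReal_empMeasure x measurableSet_Ioi]; linarith)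
      (by rw [measureReal_empMeasure x measurableSet_Ici]; linarith)
      (by rw [measureReal_empMeasure x measurableSet_Ici]; linarith)
      (by rw [measureReal_empMeasure x measurableSet_Ioi]; linarith)
    rw [← empDistFun_univ_eq hm0, tailObjective, integral_empMeasure] at hmain
    have hplug : plugIn α Finset.univ x = expShortfall α (empDistFun Finset.univ x) := rfl
    rw [← hplug] at hmain
    have hLd : L * δ * δ / α = 16 * L * ε ^ 2 := by
      rw [mul_assoc, ← sq, hδ2]
      field_simp
    rw [hLd] at hmain
    obtain ⟨hlo, hhi⟩ := hmain
    change _ ≤ q + 1 / α * sampleMean W x at hhi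
    change q + 1 / α * sampleMean W x - _ ≤ _ at hlo
    have hZ : |1 / α * sampleMean W x - 1 / α * ∫ y, W y ∂μ| < r := by
      rw [← mul_sub, abs_mul, abs_of_pos (by positivity : 0 < 1 / α), one_div,
        inv_mul_lt_iff₀ hα0]
      exact h0
    rw [abs_lt] at hZ ⊢
    rw [hES]
    have hLε : 0 ≤ 16 * L * ε ^ 2 := by positivity
    constructor <;> linarith [hZ.1, hZ.2]

end Block

/-! ### Stability of central quantiles under a minority of bad values -/

section OrderStatistics

variable {n : ℕ}

/-- A value at most `a` at position `k` would put `k + 1` indices into `S`; a value at least `b`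
would put `n - k` there. Both exceed its cardinality. -/
theorem orderStat_mem_Ioo {T : Fin n → ℝ} {a b : ℝ} {S : Finset (Fin n)}
    (hS : ∀ j ∉ S, T j ∈ Ioo a b) {k : ℕ} (hk : S.card ≤ k) (hkn : k + S.card < n) :
    orderStat T k ∈ Ioo a b := by
  have hk' : k < n := by omega
  have hmono := Tuple.monotone_sort T
  rw [orderStat, dif_pos hk']
  constructor
  · by_contra! h
    have hsub : (Finset.Iic (⟨k, hk'⟩ : Fin n)).map (Tuple.sort T).toEmbedding ⊆ S := by
      intro j hj
      obtain ⟨i, hi, rfl⟩ := Finset.mem_map.1 hj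
      by_contra hjS
      exact absurd ((hS _ hjS).1) (not_lt.2 ((hmono (Finset.mem_Iic.1 hi)).trans h))
    have := Finset.card_le_card hsub
    rw [Finset.card_map, Fin.card_Iic] at this
    simp only at this
    omega
  · by_contra! h
    have hsub : (Finset.Ici (⟨k, hk'⟩ : Fin n)).map (Tuple.sort T).toEmbedding ⊆ S := by
      intro j hj
      obtain ⟨i, hi, rfl⟩ := Finset.mem_map.1 hj
      by_contra hjS
      exact absurd ((hS _ hjS).2) (not_lt.2 (h.trans (hmono (Finset.mem_Ici.1 hi))))
    have := Finset.card_le_card hsub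
    rw [Finset.card_map, Fin.card_Ici] at this
    simp only at this
    omega

theorem interpQuantile_mem_Ioo {T : Fin n → ℝ} {a b : ℝ} {S : Finset (Fin n)}
    (hS : ∀ j ∉ S, T j ∈ Ioo a b) (hn : 100 ≤ n) (hcard : (S.card : ℝ) < 0.3 * n) {β : ℝ}
    (hβ1 : 0.35 ≤ β) (hβ2 : β ≤ 0.65) : interpQuantile T β ∈ Ioo a b := by
  have hn' : (100 : ℝ) ≤ n := by exact_mod_cast hn
  unfold interpQuantile
  set h : ℝ := ((n : ℝ) - 1) * β with hh
  have hlo : ((n : ℝ) - 1) * 0.35 ≤ h := by rw [hh]; gcongr; linarith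
  have hhi : h ≤ ((n : ℝ) - 1) * 0.65 := by rw [hh]; gcongr; linarith
  norm_num at hlo hhi hcard
  have h0 : 0 ≤ h := by linarith
  have hf1 := Nat.floor_le h0
  have hf2 := Nat.lt_floor_add_one h
  -- The gap between 0.3 and 0.35 absorbs the rounding once `n ≥ 100`. Both interpolation nodes then
  -- lie below `n`, so the default value 0 of `orderStat` never occurs.
  have hk1 : S.card ≤ ⌊h⌋₊ := by
    have : (S.card : ℝ) ≤ ⌊h⌋₊ := by linarith
    exact_mod_cast this
  have hk2 : ⌊h⌋₊ + 1 + S.card < n := by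
    have : (⌊h⌋₊ : ℝ) + 1 + S.card < n := by linarith
    exact_mod_cast this
  have m1 := orderStat_mem_Ioo hS hk1 (by omega)
  have m2 := orderStat_mem_Ioo hS (k := ⌊h⌋₊ + 1) (by omega) hk2
  have := (convex_Ioo a b) m1 m2 (a := 1 - (h - ⌊h⌋₊)) (b := h - ⌊h⌋₊)
    (by linarith) (by linarith) (by ring)
  simp only [smul_eq_mul] at this
  convert this using 1
  ring

end OrderStatistics

/-! ### Independence of the blocks and the exponential bound -/

section Blocks

/-- The `k`-th index of block `j`. -/
def blockEmb (N m : ℕ) : Fin (N / m) × Fin m ↪ Fin N where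
  toFun p := ⟨p.1 * m + p.2, by
    have h1 : ((p.1 : ℕ) + 1) * m ≤ N / m * m := Nat.mul_le_mul_right m p.1.2
    have h2 := Nat.div_mul_le_self N m
    have h3 := p.2.2
    rw [add_mul, one_mul] at h1
    omega⟩
  inj' := by
    rintro ⟨j, k⟩ ⟨j', k'⟩ h
    simp only [Fin.mk.injEq] at h
    have hk : (k : ℕ) = k' := by
      have := congrArg (· % m) h
      simpa [Nat.mod_eq_of_lt k.2, Nat.mod_eq_of_lt k'.2] using this
    have hm : 0 < m := lt_of_le_of_lt (Nat.zero_le _) k.2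
    have hj : (j : ℕ) = j' := by
      rw [hk] at h
      exact Nat.eq_of_mul_eq_mul_right hm (Nat.add_right_cancel h)
    exact Prod.ext (Fin.ext hj) (Fin.ext hk)

theorem block_eq_map (N m : ℕ) (j : Fin (N / m)) :
    block N m j =
      Finset.univ.map ⟨fun k => blockEmb N m (j, k), fun k k' h => by simpa using h⟩ := by
  ext i
  simp only [block, Finset.mem_filter, Finset.mem_univ, true_and, Finset.mem_map]
  constructor
  · rintro ⟨h1, h2⟩
    rw [add_mul, one_mul] at h2
    refine ⟨⟨i - j * m, by omega⟩, Fin.ext ?_⟩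
    change (j : ℕ) * m + (i - j * m) = i
    omega
  · rintro ⟨k, rfl⟩
    have := k.2
    change (j : ℕ) * m ≤ j * m + k ∧ (j : ℕ) * m + k < (j + 1) * m
    rw [add_mul, one_mul]
    omega

variable {Ω : Type*} [MeasurableSpace Ω] {P : Measure Ω} [IsProbabilityMeasure P]

/-- Disjoint blocks of an i.i.d. sample are i.i.d. -/
theorem iIndepFun_blocks {ι κ : Type*} [Fintype ι] [Fintype κ] {X : ι × κ → Ω → ℝ}
    (hind : iIndepFun X P) (hX : ∀ p, AEMeasurable (X p) P) {μ : Measure ℝ}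
    [IsProbabilityMeasure μ] (hμ : ∀ p, P.map (X p) = μ) :
    iIndepFun (fun i ω k => X (i, k) ω) P ∧
      ∀ i, P.map (fun ω k => X (i, k) ω) = Measure.pi fun _ : κ => μ := by
  have hm : ∀ i, AEMeasurable (fun ω k => X (i, k) ω) P := fun i =>
    aemeasurable_pi_lambda _ fun k => hX _
  have hlaw : ∀ i, P.map (fun ω k => X (i, k) ω) = Measure.pi fun _ : κ => μ := fun i => by
    have h := (iIndepFun_iff_map_fun_eq_pi_map fun k => hX (i, k)).1
      (hind.precomp (Prod.mk_right_injective i))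
    simp_rw [hμ] at h
    exact h
  refine ⟨?_, hlaw⟩
  rw [iIndepFun_iff_map_fun_eq_infinitePi_map₀' hm]
  simp_rw [hlaw]
  have h := hind.map_fun_eq_infinitePi_map₀' hX
  simp_rw [hμ] at h
  -- Currying carries the product law over `ι × κ` to the product over `ι` of products over `κ`.
  have hc := Measure.infinitePi_map_curry (ι := ι) (κ := κ) (fun _ _ => μ)
  rw [← h, AEMeasurable.map_map_of_aemeasurable (by fun_prop) (aemeasurable_pi_lambda _ hX)] at hc
  simp_rw [Measure.infinitePi_eq_pi (μ := fun _ : κ => μ)] at hc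
  exact hc

/-- If every block is bad with probability at most `1 / 8`, then it is exponentially unlikely that
three tenths of the blocks are bad. -/
theorem measureReal_many_bad_blocks_le {n m : ℕ} {X : Fin n × Fin m → Ω → ℝ}
    (hind : iIndepFun X P) (hX : ∀ p, AEMeasurable (X p) P) {μ : Measure ℝ}
    [IsProbabilityMeasure μ] (hμ : ∀ p, P.map (X p) = μ) {B : Set (Fin m → ℝ)}
    (hB : MeasurableSet B) (hB8 : (Measure.pi fun _ : Fin m => μ).real B ≤ 1 / 8) (hn : 0 < n) :
    P.real {ω | 0.3 * (n : ℝ) ≤ ∑ i, B.indicator (fun _ => (1 : ℝ)) fun k => X (i, k) ω} ≤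
      Real.exp (-0.06 * n) := by
  have hn' : (0 : ℝ) < n := by exact_mod_cast hn
  obtain ⟨hblk, hlaw⟩ := iIndepFun_blocks hind hX hμ
  have hm : ∀ i, AEMeasurable (fun ω k => X (i, k) ω) P := fun i =>
    aemeasurable_pi_lambda _ fun k => hX _
  have hBm : Measurable (B.indicator fun _ => (1 : ℝ)) := measurable_const.indicator hB
  set V : Fin n → Ω → ℝ := fun i ω => B.indicator (fun _ => (1 : ℝ)) fun k => X (i, k) ω with hV
  have hVm : ∀ i, AEMeasurable (V i) P := fun i => hBm.comp_aemeasurable (hm i)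
  have hmean : ∀ i, P[V i] ≤ 1 / 8 := fun i => by
    have h : P[V i] = (Measure.pi fun _ : Fin m => μ).real B := by
      rw [← hlaw i, hV]
      rw [← integral_map (hm i) hBm.aestronglyMeasurable (f := B.indicator fun _ => (1 : ℝ)),
        integral_indicator_const _ hB, smul_eq_mul, mul_one]
    rw [h]
    exact hB8
  have hsub : ∀ i ∈ Finset.univ, HasSubgaussianMGF (fun ω => V i ω - P[V i])
      ((‖(1 : ℝ) - 0‖₊ / 2) ^ 2) P := fun i _ =>
    hasSubgaussianMGF_of_mem_Icc (hVm i) (Eventually.of_forall fun ω => by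
      by_cases h : (fun k => X (i, k) ω) ∈ B <;> simp [hV, h])
  have hVind : iIndepFun (fun i ω => V i ω - P[V i]) P :=
    hblk.comp (fun i x => B.indicator (fun _ => (1 : ℝ)) x - ∫ ω, V i ω ∂P) fun i =>
      hBm.sub_const _
  -- The excess is 0.175 = 0.3 - 1/8; with variance proxy 1/4 the exponent is -2 · 0.175² n =
  -- -0.06125 n.
  have h := HasSubgaussianMGF.measure_sum_ge_le_of_iIndepFun hVind hsub
    (ε := 0.175 * n) (by positivity)
  refine le_trans (measureReal_mono fun ω hω => ?_) (h.trans (Real.exp_le_exp.2 ?_))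
  · rw [mem_ofPred_eq] at hω ⊢
    rw [Finset.sum_sub_distrib]
    have h1 : ∑ i, P[V i] ≤ ∑ _i : Fin n, (1 / 8 : ℝ) := Finset.sum_le_sum fun i _ => hmean i
    simp only [Finset.sum_const, Finset.card_univ, Fintype.card_fin, nsmul_eq_mul] at h1
    have h2 : ∑ i, V i ω = ∑ i, B.indicator (fun _ => (1 : ℝ)) fun k => X (i, k) ω := rfl
    norm_num at hω h1 ⊢
    linarith
  · simp only [sub_zero, nnnorm_one, Finset.sum_const, Finset.card_univ, Fintype.card_fin,
      nsmul_eq_mul]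
    push_cast
    rw [div_le_iff₀ (by positivity)]
    norm_num
    nlinarith [sq_nonneg (n : ℝ)]

/-- Rounding up gives `m ε² ≤ 12`, hence `N ε² ≤ 12 (n + 1)`; the constant 1212 = 12 · 101 then
forces `n ≥ 100`. -/
theorem numBlocks_bounds {ε : ℝ} (hε : 0 < ε) (hε1 : ε ≤ 1) {N : ℕ} (hN : 1212 / ε ^ 2 ≤ N) :
    100 ≤ numBlocks ε N ∧ N * ε ^ 2 ≤ 24 * numBlocks ε N := by
  have he : 0 < ε ^ 2 := by positivity
  have he1 : ε ^ 2 ≤ 1 := by nlinarith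
  have hm0 : 0 < blockSize ε := Nat.ceil_pos.2 (by positivity)
  have hm : (blockSize ε : ℝ) * ε ^ 2 ≤ 12 := by
    have h : (blockSize ε : ℝ) ≤ 11 / ε ^ 2 + 1 := (Nat.ceil_lt_add_one (by positivity)).le
    calc (blockSize ε : ℝ) * ε ^ 2 ≤ (11 / ε ^ 2 + 1) * ε ^ 2 := by gcongr
      _ = 11 + ε ^ 2 := by field_simp
      _ ≤ 12 := by linarith
  have hlt : (N : ℝ) ≤ ((numBlocks ε N : ℝ) + 1) * blockSize ε := by
    have := (Nat.lt_div_mul_add hm0 (a := N)).le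
    rw [numBlocks, add_mul, one_mul]
    exact_mod_cast this
  have h12 : N * ε ^ 2 ≤ ((numBlocks ε N : ℝ) + 1) * 12 := by
    calc N * ε ^ 2 ≤ ((numBlocks ε N : ℝ) + 1) * blockSize ε * ε ^ 2 := by gcongr
      _ = ((numBlocks ε N : ℝ) + 1) * (blockSize ε * ε ^ 2) := by ring
      _ ≤ _ := by gcongr
  rw [div_le_iff₀ he] at hN
  have h100 : (100 : ℝ) ≤ numBlocks ε N := by linarith
  exact ⟨by exact_mod_cast h100, by linarith⟩

theorem blockEstimates_eq (α ε : ℝ) {N : ℕ} (x : Fin N → ℝ) (j : Fin (numBlocks ε N)) :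
    blockEstimates α ε x j =
      plugIn α Finset.univ fun k => x (blockEmb N (blockSize ε) (j, k)) := by
  rw [blockEstimates, block_eq_map N (blockSize ε) j, plugIn_image]
  rfl

theorem min_max_mem_Ioo {a b t x y : ℝ} (hx : x ∈ Ioo a b) (hy : y ∈ Ioo a b) :
    min (max t x) y ∈ Ioo a b :=
  ⟨lt_min (lt_of_lt_of_le hx.1 (le_max_right _ _)) hy.1, lt_of_le_of_lt (min_le_right _ _) hy.2⟩

theorem distFun_eq_cdf {Y : Ω → ℝ} (hY : AEMeasurable Y P) :
    distFun P Y = cdf (P.map Y) := by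
  have := Measure.isProbabilityMeasure_map hY
  ext t
  rw [cdf_eq_real, map_measureReal_apply_of_aemeasurable hY measurableSet_Iic]
  rfl

theorem truncatedEstimator_tail {α : ℝ} (hα0 : 0 < α) (hα1 : α < 1 / 2) {β₁ β₂ : ℝ}
    (hβ1 : 0.35 ≤ β₁) (hβ : β₁ ≤ β₂) (hβ2 : β₂ ≤ 0.65) {Y : Ω → ℝ} {N : ℕ} {X : Fin N → Ω → ℝ}
    (hind : iIndepFun X P) (hid : ∀ i, IdentDistrib (X i) Y P P)
    (hσ : esVariance α (distFun P Y) ≠ ∞) {L : ℝ≥0}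
    (hL : LipschitzOnWith L (valueAtRisk (distFun P Y)) (Icc (1 - 2 * α) (1 - α / 2)))
    (hpos : 0 < L ∨ 0 < esStdDev α (distFun P Y)) {ε : ℝ} (hε : 0 < ε) (hε1 : ε < 1 / 8 * √α)
    (hN : 1212 / ε ^ 2 ≤ N) :
    P.real {ω | ε * esStdDev α (distFun P Y) + 32 * L * ε ^ 2 ≤
        |truncatedEstimator α ε β₁ β₂ (fun i => X i ω) - expShortfall α (distFun P Y)|} ≤
      Real.exp (-(1 / 400) * N * ε ^ 2) := by
  have hle1 : ε ≤ 1 := by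
    have : √α ≤ 1 := Real.sqrt_le_one.2 (by linarith)
    linarith
  obtain ⟨hn, hNn⟩ := numBlocks_bounds hε hle1 hN
  have hX : ∀ i, AEMeasurable (X i) P := fun i => (hid i).aemeasurable_fst
  have hY : AEMeasurable Y P := by
    have hNpos : (0 : ℝ) < N := lt_of_lt_of_le (by positivity) hN
    exact (hid ⟨0, by exact_mod_cast hNpos⟩).aemeasurable_snd
  have := Measure.isProbabilityMeasure_map hY
  rw [distFun_eq_cdf hY] at hσ hL hpos ⊢
  obtain ⟨B, hB, hB8, hgood⟩ := exists_block_bad_set (P.map Y) (m := blockSize ε) hα0 hα1 hσ hL hpos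
    hε hε1 (Nat.le_ceil _)
  set r := ε * esStdDev α (cdf (P.map Y)) + 32 * L * ε ^ 2 with hr
  set E := expShortfall α (cdf (P.map Y)) with hE
  let e := blockEmb N (blockSize ε)
  have hprob := measureReal_many_bad_blocks_le (X := fun p => X (e p)) (hind.precomp e.injective)
    (fun p => hX _) (fun p => (hid (e p)).map_eq) hB hB8 (lt_of_lt_of_le (by norm_num) hn)
  refine le_trans (measureReal_mono fun ω hω => ?_) (hprob.trans (Real.exp_le_exp.2 ?_))
  · rw [mem_ofPred_eq] at hω ⊢
    by_contra! hlt
    refine absurd hω (not_le.2 ?_)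
    classical
    let S : Finset (Fin (numBlocks ε N)) :=
      Finset.univ.filter fun j => (fun k => X (e (j, k)) ω) ∈ B
    have hcard : (S.card : ℝ) < 0.3 * numBlocks ε N := by
      refine lt_of_eq_of_lt ?_ hlt
      simp only [S, Finset.card_filter, indicator]
      push_cast
      rfl
    have hS : ∀ j ∉ S, blockEstimates α ε (fun i => X i ω) j ∈ Ioo (E - r) (E + r) := by
      intro j hj
      have hj' : (fun k => X (e (j, k)) ω) ∉ B := fun h => hj (by simp [S, h])
      have h := abs_lt.1 (hgood _ hj')
      rw [blockEstimates_eq]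
      constructor <;> linarith [h.1, h.2]
    have hmem := min_max_mem_Ioo (t := plugIn α Finset.univ fun i => X i ω)
      (interpQuantile_mem_Ioo hS hn hcard hβ1 (hβ.trans hβ2))
      (interpQuantile_mem_Ioo hS hn hcard (hβ1.trans hβ) hβ2)
    change truncatedEstimator α ε β₁ β₂ (fun i => X i ω) ∈ Ioo (E - r) (E + r) at hmem
    rw [abs_lt]
    constructor <;> linarith [hmem.1, hmem.2]
  -- Since `n ≥ N ε² / 24`, the rate is 0.06 / 24 = 1/400.
  · change -0.06 * (numBlocks ε N : ℝ) ≤ _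
    norm_num
    linarith

end Blocks

end ExpShortfall

theorem mainTheorem7 :
    ∃ c₀ c₁ c₂ c₃ : ℝ, 0 < c₀ ∧ 0 < c₁ ∧ 0 < c₂ ∧ 0 < c₃ ∧
      ∀ (Ω : Type*) [MeasurableSpace Ω] (P : Measure Ω) [IsProbabilityMeasure P]
        (α : ℝ) (_ : 0 < α) (_ : α < 1 / 2)
        (β₁ β₂ : ℝ) (_ : 0.35 ≤ β₁) (_ : β₁ ≤ β₂) (_ : β₂ ≤ 0.65)
        -- the loss `Y` and the i.i.d. sample `X` of size `N`
        (Y : Ω → ℝ) (N : ℕ) (X : Fin N → Ω → ℝ)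
        (_ : iIndepFun X P) (_ : ∀ i, IdentDistrib (X i) Y P P)
        (_ : ExpShortfall.esVariance α (ExpShortfall.distFun P Y) ≠ ∞)
        (L : ℝ≥0)
        (_ : LipschitzOnWith L (ExpShortfall.valueAtRisk (ExpShortfall.distFun P Y))
          (Set.Icc (1 - 2 * α) (1 - α / 2)))
        -- the error scales are not both zero
        (_ : 0 < L ∨ 0 < ExpShortfall.esStdDev α (ExpShortfall.distFun P Y))
        (ε : ℝ) (_ : 0 < ε) (_ : ε < c₀ * Real.sqrt α) (_ : c₁ / ε ^ 2 ≤ (N : ℝ)),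
        -- the constants are those of the general bound
        P.real {ω | ε * ExpShortfall.esStdDev α (ExpShortfall.distFun P Y) + c₂ * L * ε ^ 2 ≤
            |ExpShortfall.truncatedEstimator α ε β₁ β₂ (fun i => X i ω) -
              ExpShortfall.expShortfall α (ExpShortfall.distFun P Y)|}
          ≤ Real.exp (-c₃ * N * ε ^ 2) ∧
        -- the purely Gaussian bound; for `L > 0` the condition is `ε ≤ σ / (c₂ L)`
        (ε * (c₂ * L) ≤ ExpShortfall.esStdDev α (ExpShortfall.distFun P Y) →
          P.real {ω | 2 * ε * ExpShortfall.esStdDev α (ExpShortfall.distFun P Y) ≤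
              |ExpShortfall.truncatedEstimator α ε β₁ β₂ (fun i => X i ω) -
                ExpShortfall.expShortfall α (ExpShortfall.distFun P Y)|}
            ≤ Real.exp (-c₃ * N * ε ^ 2)) := by
  refine ⟨1 / 8, 1212, 32, 1 / 400, by norm_num, by norm_num, by norm_num, by norm_num, ?_⟩
  intro Ω _ P _ α hα0 hα1 β₁ β₂ hβ1 hβ hβ2 Y N X hind hid hσ L hL hpos ε hε hε1 hN
  have h := ExpShortfall.truncatedEstimator_tail hα0 hα1 hβ1 hβ hβ2 hind hid hσ hL hpos hε hε1 hN
  refine ⟨h, fun hle => le_trans (measureReal_mono fun ω hω => ?_) h⟩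
  rw [Set.mem_ofPred_eq] at hω ⊢
  refine le_trans ?_ hω
  -- The extra condition says `32 L ε² ≤ ε σ`, so the threshold `2 ε σ` dominates the general one.
  have h1 := mul_le_mul_of_nonneg_left hle hε.le
  nlinarith
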